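/- Let $\Omega=(a,b)\subset\mathbb R$ be a bounded open interval and let $T>0$, $M_1,M_2>0$. Let $\Phi_1,\Phi_2\in C^1(\Omega)$ be semi-convex with bounded derivatives, $L:=\max_{i}\|\partial_x\Phi_i\|_{L^\infty(\Omega)}<\infty$, and with ordered drifts, $\partial_x\Phi_1\le\partial_x\Phi_2$ on $\Omega$. Let $\rho^1_0,\rho^2_0\ge 0$ be densities on $\Omega$ of masses $M_1,M_2$ whose supports are ordered: for a.e. $x\in\{\rho^1_0>0\}$ and a.e. $y\in\{\rho^2_0>0\}$ one has $y<x$. Let $(\rho^{1,\infty},\rho^{2,\infty},p^\infty)$ be a weak solution of $(\mathrm{PME}_\infty)$ with these data, that is: for $i=1,2$, $\rho^{i,\infty}\in AC^2([0,T];(\mathcal P^{M_i}(\Omega),W_2))\cap L^\infty([0,T]\times\Omega)$, where $\mathcal P^{M}(\Omega)$ is the set of nonnegative measures on $\Omega$ of mass $M$ and absolutely continuous measures are identified with their densities; $\|\rho^{1,\infty}+\rho^{2,\infty}\|_{L^\infty}\le 1$; $p^\infty\in L^2([0,T];H^1(\Omega))$, $p^\infty\ge 0$ and $p^\infty(1-\rho^{1,\infty}-\rho^{2,\infty})=0$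 a.e. in $[0,T]\times\Omega$; $\rho^{i,\infty}|_{t=0}=\rho^i_0$; and for all $\phi\in C^1([0,T]\times\overline\Omega)$, all $0\le s<t\le T$ and $i=1,2$, $$-\int_s^t\!\!\int_\Omega\rho^{i,\infty}\,\partial_t\phi\,dx\,d\tau+\int_s^t\!\!\int_\Omega(\partial_xp^\infty+\partial_x\Phi_i)\,\partial_x\phi\,\rho^{i,\infty}\,dx\,d\tau=\int_\Omega\rho^{i,\infty}_s\phi(s,\cdot)\,dx-\int_\Omega\rho^{i,\infty}_t\phi(t,\cdot)\,dx .$$ Then there is a constant $C$, depending only on $L$, such that for a.e. $t\in[0,T]$ the function $p^\infty(t,\cdot)$ has a representative that is Lipschitz continuous on $\Omega$ with constant $C$ and has the following properties for $i=1,2$. Let $U_i(t)$ be the interior of $\{\rho^{i,\infty}_t=1\}$, i.e. the largest open subset of $\Omega$ on which $\rho^{i,\infty}_t=1$ a.e. Then on $U_i(t)$ the function $p^\infty(t,\cdot)$ is as smooth as $\Phi_i$ (near every point of $U_i(t)$ at which $\Phi_i$ is of class $C^n$, where $n\in\mathbb N\cup\{\infty,\omega\}$, so is $p^\infty(t,\cdot)$),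 and $-\partial_{xx}^2p^\infty(t,\cdot)=\partial_{xx}^2\Phi_i$ in the sense of distributions on $U_i(t)$. -/

import Mathlib

open MeasureTheory Set
open scoped ENNReal NNReal ContDiff

noncomputable section

/-- Smooth test functions with compact support in the open set `U ⊆ ℝ`. -/
def IsTestFunction (U : Set ℝ) (φ : ℝ → ℝ) : Prop :=
  ContDiff ℝ ∞ φ ∧ HasCompactSupport φ ∧ tsupport φ ⊆ U

/-- `g` is the weak derivative of `f` on the open interval `(a, b)`. -/
def HasWeakDeriv (a b : ℝ) (f g : ℝ → ℝ) : Prop :=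
  ∀ φ : ℝ → ℝ, IsTestFunction (Ioo a b) φ →
    ∫ x in Ioo a b, f x * deriv φ x = -∫ x in Ioo a b, g x * φ x

/-- The 2-Wasserstein distance between two measures on `ℝ` of equal mass: the square root of the
infimum of `∫ |x - y|² dγ` over all transport plans `γ` with marginals `μ` and `ν`. -/
def wasserstein2 (μ ν : Measure ℝ) : ℝ≥0∞ :=
  (⨅ γ ∈ {γ : Measure (ℝ × ℝ) | γ.map Prod.fst = μ ∧ γ.map Prod.snd = ν},
    ∫⁻ z, edist z.1 z.2 ^ 2 ∂γ) ^ (1 / 2 : ℝ)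

/-- `μ ∈ AC²([0,T]; W₂)`: absolute continuity with a square integrable bound on the
metric speed. -/
def IsAC2Curve (T : ℝ) (μ : ℝ → Measure ℝ) : Prop :=
  ∃ g : ℝ → ℝ, MemLp g 2 (volume.restrict (Icc 0 T)) ∧
    ∀ s t : ℝ, 0 ≤ s → s ≤ t → t ≤ T →
      wasserstein2 (μ s) (μ t) ≤ ENNReal.ofReal (∫ r in s..t, g r)

/-- The measure `f dx` on `(a, b)`. -/
def densityMeasure (a b : ℝ) (f : ℝ → ℝ) : Measure ℝ :=
  (volume.restrict (Ioo a b)).withDensity fun x => ENNReal.ofReal (f x)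

/-- Lebesgue measure on the space-time cylinder `[0, T] × (a, b)`. -/
def cylinderMeasure (T a b : ℝ) : Measure (ℝ × ℝ) :=
  volume.restrict (Icc 0 T ×ˢ Ioo a b)

/-- `t ↦ ρ t` is a curve in `AC²([0,T]; 𝒫^M(a,b)) ∩ L^∞([0,T] × (a,b))`, where a measure is
identified with its density: for every time `t` the function `ρ t` is a nonnegative density of
mass `M`. -/
structure IsDensityCurve (T a b M : ℝ) (ρ : ℝ → ℝ → ℝ) : Prop where
  memLp_top : MemLp (fun z : ℝ × ℝ => ρ z.1 z.2) ⊤ (cylinderMeasure T a b)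
  nonneg : ∀ t ∈ Icc 0 T, ∀ᵐ x ∂volume.restrict (Ioo a b), 0 ≤ ρ t x
  integrable : ∀ t ∈ Icc 0 T, IntegrableOn (ρ t) (Ioo a b)
  mass : ∀ t ∈ Icc 0 T, ∫ x in Ioo a b, ρ t x = M
  ac2 : IsAC2Curve T fun t => densityMeasure a b (ρ t)

/-- The weak form of `∂ₜρ - ∂ₓ((q + Φ') ρ) = 0` on `[0, T] × (a, b)`, where `q` stands for `∂ₓp`.
The test functions are `C¹` up to the boundary and need not vanish there, so the no-flux condition
is part of the equation. -/
def SatisfiesWeakEquation (T a b : ℝ) (Φ : ℝ → ℝ) (ρ q : ℝ → ℝ → ℝ) : Prop :=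
  ∀ φ : ℝ × ℝ → ℝ, ContDiff ℝ 1 φ → ∀ s t : ℝ, 0 ≤ s → s < t → t ≤ T →
    -(∫ r in s..t, ∫ x in Ioo a b, ρ r x * deriv (fun r' => φ (r', x)) r)
        + ∫ r in s..t, ∫ x in Ioo a b,
            (q r x + deriv Φ x) * deriv (fun x' => φ (r, x')) x * ρ r x
      = (∫ x in Ioo a b, ρ s x * φ (s, x)) - ∫ x in Ioo a b, ρ t x * φ (t, x)

/-- `(ρ₁, ρ₂, p)` is a weak solution on `[0, T] × (a, b)`, with initial densities `ρ₁₀, ρ₂₀` of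
masses `M₁, M₂`, of the system
`∂ₜρᵢ - ∂ₓ((∂ₓp + Φᵢ') ρᵢ) = 0`, `ρ₁ + ρ₂ ≤ 1`, `p ≥ 0`, `p (1 - ρ₁ - ρ₂) = 0`
with no-flux boundary conditions. The function `q` is the weak derivative `∂ₓp`, and
`p ∈ L²([0,T]; H¹(a,b))`. -/
def IsWeakSolutionPMEInfty (T a b M₁ M₂ : ℝ) (Φ₁ Φ₂ ρ₁₀ ρ₂₀ : ℝ → ℝ)
    (ρ₁ ρ₂ p : ℝ → ℝ → ℝ) : Prop :=
  IsDensityCurve T a b M₁ ρ₁ ∧ IsDensityCurve T a b M₂ ρ₂ ∧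
  eLpNorm (fun z : ℝ × ℝ => ρ₁ z.1 z.2 + ρ₂ z.1 z.2) ⊤ (cylinderMeasure T a b) ≤ 1 ∧
  (∀ᵐ z ∂cylinderMeasure T a b, 0 ≤ p z.1 z.2) ∧
  (∀ᵐ z ∂cylinderMeasure T a b, p z.1 z.2 * (1 - ρ₁ z.1 z.2 - ρ₂ z.1 z.2) = 0) ∧
  (∀ᵐ x ∂volume.restrict (Ioo a b), ρ₁ 0 x = ρ₁₀ x) ∧
  (∀ᵐ x ∂volume.restrict (Ioo a b), ρ₂ 0 x = ρ₂₀ x) ∧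
  ∃ q : ℝ → ℝ → ℝ,
    MemLp (fun z : ℝ × ℝ => p z.1 z.2) 2 (cylinderMeasure T a b) ∧
    MemLp (fun z : ℝ × ℝ => q z.1 z.2) 2 (cylinderMeasure T a b) ∧
    (∀ᵐ t ∂volume.restrict (Icc 0 T), HasWeakDeriv a b (p t) (q t)) ∧
    SatisfiesWeakEquation T a b Φ₁ ρ₁ q ∧
    SatisfiesWeakEquation T a b Φ₂ ρ₂ q

/-- `f` is semi-convex on `(a, b)`: it becomes convex after adding a multiple of `x²`. -/
def IsSemiconvex (a b : ℝ) (f : ℝ → ℝ) : Prop :=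
  ∃ c : ℝ, ConvexOn ℝ (Ioo a b) fun x => f x + c * x ^ 2

/-- The one-dimensional ordered framework: semi-convex `C¹` potentials with ordered drifts, and
initial densities such that the set `{ρ₂₀ > 0}` lies to the left of `{ρ₁₀ > 0}`. -/
structure OrderedSetting1D (a b : ℝ) (Φ₁ Φ₂ ρ₁₀ ρ₂₀ : ℝ → ℝ) : Prop where
  contDiff₁ : ContDiffOn ℝ 1 Φ₁ (Ioo a b)
  contDiff₂ : ContDiffOn ℝ 1 Φ₂ (Ioo a b)
  semiconvex₁ : IsSemiconvex a b Φ₁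
  semiconvex₂ : IsSemiconvex a b Φ₂
  drift_le : ∀ x ∈ Ioo a b, deriv Φ₁ x ≤ deriv Φ₂ x
  supports_ordered : ∀ᵐ x ∂volume.restrict (Ioo a b), ∀ᵐ y ∂volume.restrict (Ioo a b),
    0 < ρ₁₀ x → 0 < ρ₂₀ y → y < x

/-- The interior in `(a, b)` of the set `{f = 1}`, for `f` defined up to null sets: the largest
open subset of `(a, b)` on which `f = 1` almost everywhere. -/
def interiorEqOne (a b : ℝ) (f : ℝ → ℝ) : Set ℝ :=
  ⋃₀ {V : Set ℝ | IsOpen V ∧ V ⊆ Ioo a b ∧ ∀ᵐ x ∂volume.restrict V, f x = 1}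

/-- On the open set `U ⊆ (a, b)` the function `u` is as smooth as `Φ` (in the classes `Cⁿ`,
where `n` is finite, `∞`, or `ω` for analyticity). -/
def IsAsSmoothAsOn (U : Set ℝ) (u Φ : ℝ → ℝ) : Prop :=
  ∀ x ∈ U, ∀ n : WithTop ℕ∞, ContDiffAt ℝ n Φ x → ContDiffAt ℝ n u x

/-- `-u'' = Φ''` in the sense of distributions on the open set `U`. -/
def NegSecondDerivEqOn (U : Set ℝ) (u Φ : ℝ → ℝ) : Prop :=
  ∀ φ : ℝ → ℝ, IsTestFunction U φ →
    -(∫ x in U, u x * iteratedDeriv 2 φ x) = ∫ x in U, Φ x * iteratedDeriv 2 φ x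

end

/-! Write `q = ∂ₓp`, so that a density `σ` solves `∂ₜσ = ∂ₓJ`, where `σ` is one species or the sum
of both. For a cut-off `φ` with values in `[0, 1]`, the function `t ↦ ∫ σ φ` never exceeds `∫ φ`,
and its derivative is `-∫ J φ'` almost everywhere. Where it attains this maximum, the derivative
vanishes (`ae_eq_zero_of_primitive_eq_max`). If `φ` is a smoothed indicator of `[α, β]`, then `φ'`
is a bump at `α` minus a bump at `β`, so `J` takes the same averages near `α` and `β`. Hence `J` is
constant on intervals where `σ = 1` (`ae_const_of_saturated`, `PlateauContinuityEq.ae_const`).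
Cut-offs may cross the boundary, where `J` is extended by zero; the constant is then zero.

Lipschitz bound (`ae_abs_le_of_flux_const`): where `p > 0` the total density is `1`, so the total
flux is `q + g`, with `g` a convex combination of the two drifts and `|g| ≤ L`. On a component of
`{p > 0}` this flux is a constant `c`. Either the component reaches past the boundary and `c = 0`,
or `p` vanishes at both ends, `q` has mean zero and `c` is the mean of `g`. So `|c| ≤ L` and `|q| =
|c - g| ≤ 2L`. Where `p = 0`, a minimum, `q = 0` almost everywhere.

Regularity (`affineSumOn_interiorEqOne`): where `ρᵢ = 1` the flux of species `i` alone is `q + Φᵢ'`.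
It is locally constant, so `p + Φᵢ` is locally affine. -/

/-! ### Times at which a primitive attains its maximum -/

open Filter Topology in
/-- If `f` is a primitive of `-g` on `[0, T]` bounded above by `M`, then `g` vanishes at almost
every time at which `f` attains the value `M`. -/
theorem ae_eq_zero_of_primitive_eq_max {T M : ℝ} {f g : ℝ → ℝ}
    (hg : IntegrableOn g (Icc 0 T))
    (hfg : ∀ s t, 0 ≤ s → s < t → t ≤ T → f s - f t = ∫ r in s..t, g r)
    (hM : ∀ᵐ t ∂volume.restrict (Icc 0 T), f t ≤ M) :
    ∀ᵐ t ∂volume.restrict (Icc 0 T), f t = M → g t = 0 := by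
  set G := (Icc 0 T).indicator g with hG
  have hGi : Integrable G := hg.integrable_indicator measurableSet_Icc
  set F : ℝ → ℝ := fun t => f 0 - ∫ r in (0 : ℝ)..t, G r with hF
  have hFc : Continuous F :=
    continuous_const.sub (intervalIntegral.continuous_primitive
      (fun _ _ => hGi.intervalIntegrable) 0)
  have hfF : ∀ t ∈ Ioo 0 T, f t = F t := by
    intro t ht
    have h1 := hfg 0 t le_rfl ht.1 ht.2.le
    have h2 : ∫ r in (0 : ℝ)..t, G r = ∫ r in (0 : ℝ)..t, g r := by
      apply intervalIntegral.integral_congr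
      intro r hr
      rw [uIcc_of_le ht.1.le] at hr
      have hr' : r ∈ Icc 0 T := ⟨hr.1, hr.2.trans ht.2.le⟩
      exact indicator_of_mem hr' g
    simp only [hF, h2]
    linarith
  have hFM : ∀ t ∈ Ioo 0 T, F t ≤ M := by
    -- The bound is known at almost every time only; continuity of `F` makes the exceptional set
    -- open, and an open null set is empty.
    have ho : IsOpen (Ioo 0 T ∩ {t | M < F t}) := isOpen_Ioo.inter (isOpen_lt continuous_const hFc)
    have h0 : volume (Ioo 0 T ∩ {t | M < F t}) = 0 := by
      rw [ae_restrict_iff' measurableSet_Icc] at hM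
      refine measure_mono_null ?_ hM
      rintro t ⟨ht, hlt⟩ hc
      have := hc (Ioo_subset_Icc_self ht)
      rw [hfF t ht] at this
      exact absurd hlt (not_lt.2 this)
    have he := ho.eq_empty_of_measure_zero h0
    intro t ht
    by_contra hc
    have : t ∈ Ioo 0 T ∩ {t | M < F t} := ⟨ht, not_le.1 hc⟩
    rw [he] at this
    exact this
  rw [← restrict_Ioo_eq_restrict_Icc, ae_restrict_iff' measurableSet_Ioo]
  filter_upwards [LocallyIntegrable.ae_hasDerivAt_integral hGi.locallyIntegrable] with t ht htI hft
  have hd : HasDerivAt F (-G t) t := by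
    simpa using (ht 0).const_sub (f 0)
  have hmax : IsLocalMax F t := by
    filter_upwards [isOpen_Ioo.mem_nhds htI] with s hs
    rw [← hfF t htI, hft]
    exact hFM s hs
  have h0 := hmax.hasDerivAt_eq_zero hd
  have : G t = g t := Set.indicator_of_mem (Ioo_subset_Icc_self htI) g
  linarith

/-! ### Smooth cut-off functions -/

/-- The primitive of a normalized bump function: a smoothed Heaviside function. -/
noncomputable def bumpStep (k : ContDiffBump (0 : ℝ)) (x : ℝ) : ℝ :=
  ∫ y in (-k.rOut)..x, k.normed volume y

namespace bumpStep

variable (k : ContDiffBump (0 : ℝ))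

theorem hasDerivAt (x : ℝ) : HasDerivAt (bumpStep k) (k.normed volume x) x :=
  intervalIntegral.integral_hasDerivAt_right (k.continuous_normed.intervalIntegrable _ _)
    (k.continuous_normed.stronglyMeasurableAtFilter _ _) k.continuous_normed.continuousAt

theorem deriv_eq : deriv (bumpStep k) = k.normed volume := funext fun x => (hasDerivAt k x).deriv

theorem contDiff : ContDiff ℝ ∞ (bumpStep k) := by
  rw [contDiff_infty_iff_deriv, deriv_eq]
  exact ⟨fun x => (hasDerivAt k x).differentiableAt, k.contDiff_normed⟩

theorem monotone : Monotone (bumpStep k) := by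
  apply monotone_of_deriv_nonneg (fun x => (hasDerivAt k x).differentiableAt)
  intro x
  rw [deriv_eq]
  exact k.nonneg_normed x

theorem normed_eq_zero {x : ℝ} (hx : k.rOut ≤ |x|) : k.normed volume x = 0 := by
  have : x ∉ Function.support (k.normed volume) := by
    rw [k.support_normed_eq]
    simpa using hx
  simpa using this

theorem eq_zero {x : ℝ} (hx : x ≤ -k.rOut) : bumpStep k x = 0 := by
  apply intervalIntegral.integral_zero_ae
  refine Filter.Eventually.of_forall fun y hy => normed_eq_zero k ?_
  rw [uIoc_of_ge hx] at hy
  rw [abs_of_neg (by linarith [hy.2, k.rOut_pos])]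
  linarith [hy.2]

theorem eq_one {x : ℝ} (hx : k.rOut ≤ x) : bumpStep k x = 1 := by
  rw [bumpStep, intervalIntegral.integral_of_le (by linarith [k.rOut_pos]),
    setIntegral_eq_integral_of_forall_compl_eq_zero, k.integral_normed]
  intro y hy
  apply normed_eq_zero
  by_contra! h
  rw [abs_lt] at h
  exact hy ⟨h.1, h.2.le.trans hx⟩

theorem nonneg (x : ℝ) : 0 ≤ bumpStep k x := by
  rw [← eq_zero k (min_le_right x (-k.rOut))]
  exact monotone k (min_le_left _ _)

theorem le_one (x : ℝ) : bumpStep k x ≤ 1 := by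
  rw [← eq_one k (le_max_right x k.rOut)]
  exact monotone k (le_max_left _ _)

end bumpStep

/-- A smoothed indicator function of the interval `[α, β]`. -/
noncomputable def plateau (k : ContDiffBump (0 : ℝ)) (α β x : ℝ) : ℝ :=
  bumpStep k (x - α) - bumpStep k (x - β)

namespace plateau

variable (k : ContDiffBump (0 : ℝ)) {α β : ℝ}

theorem hasDerivAt (α β x : ℝ) :
    HasDerivAt (plateau k α β) (k.normed volume (x - α) - k.normed volume (x - β)) x :=
  ((bumpStep.hasDerivAt k (x - α)).comp_sub_const x α).sub
    ((bumpStep.hasDerivAt k (x - β)).comp_sub_const x β)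

theorem deriv_eq (α β x : ℝ) :
    deriv (plateau k α β) x = k.normed volume (x - α) - k.normed volume (x - β) :=
  (hasDerivAt k α β x).deriv

theorem contDiff (α β : ℝ) : ContDiff ℝ ∞ (plateau k α β) :=
  ((bumpStep.contDiff k).comp (contDiff_id.sub contDiff_const)).sub
    ((bumpStep.contDiff k).comp (contDiff_id.sub contDiff_const))

theorem nonneg (h : α ≤ β) (x : ℝ) : 0 ≤ plateau k α β x :=
  sub_nonneg.2 (bumpStep.monotone k (by linarith))

theorem le_one (α β x : ℝ) : plateau k α β x ≤ 1 := by
  have h1 := bumpStep.le_one k (x - α)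
  have h2 := bumpStep.nonneg k (x - β)
  unfold plateau
  linarith

theorem eq_zero_left (h : α ≤ β) {x : ℝ} (hx : x ≤ α - k.rOut) : plateau k α β x = 0 := by
  rw [plateau, bumpStep.eq_zero k (by linarith), bumpStep.eq_zero k (by linarith), sub_zero]

theorem eq_zero_right (h : α ≤ β) {x : ℝ} (hx : β + k.rOut ≤ x) : plateau k α β x = 0 := by
  rw [plateau, bumpStep.eq_one k (by linarith), bumpStep.eq_one k (by linarith), sub_self]

theorem eq_one {x : ℝ} (h1 : α + k.rOut ≤ x) (h2 : x ≤ β - k.rOut) : plateau k α β x = 1 := by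
  rw [plateau, bumpStep.eq_one k (by linarith), bumpStep.eq_zero k (by linarith), sub_zero]

theorem tsupport_subset (h : α ≤ β) :
    tsupport (plateau k α β) ⊆ Icc (α - k.rOut) (β + k.rOut) := by
  apply closure_minimal _ isClosed_Icc
  intro x hx
  by_contra hc
  rw [mem_Icc, not_and_or, not_le, not_le] at hc
  rcases hc with hc | hc
  · exact hx (eq_zero_left k h hc.le)
  · exact hx (eq_zero_right k h hc.le)

theorem isTestFunction {a b : ℝ} (h : α ≤ β) (ha : a < α - k.rOut) (hb : β + k.rOut < b) :
    IsTestFunction (Ioo a b) (plateau k α β) :=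
  ⟨contDiff k α β, HasCompactSupport.of_support_subset_isCompact isCompact_Icc
    (subset_tsupport _ |>.trans (tsupport_subset k h)),
    (tsupport_subset k h).trans (Icc_subset_Ioo ha hb)⟩

end plateau

/-! ### Mollification -/

/-- A sequence of bump functions concentrating at `0`. -/
noncomputable def shrinkingBump (n : ℕ) : ContDiffBump (0 : ℝ) where
  -- The ratio `rOut / rIn` stays equal to 2; almost everywhere convergence of the mollifications
  -- needs it bounded (`K := 2` below).
  rIn := 1 / (n + 1) / 2
  rOut := 1 / (n + 1)
  rIn_pos := by positivity
  rIn_lt_rOut := half_lt_self (by positivity)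

open Filter Topology in
theorem tendsto_shrinkingBump_rOut : Tendsto (fun n => (shrinkingBump n).rOut) atTop (𝓝 0) :=
  tendsto_one_div_add_atTop_nhds_zero_nat

/-- The mollification of `g` at scale `n`. -/
noncomputable def mollify (n : ℕ) (g : ℝ → ℝ) (x : ℝ) : ℝ :=
  ∫ y, g y * (shrinkingBump n).normed volume (y - x)

open scoped Convolution in
theorem mollify_eq_convolution (n : ℕ) (g : ℝ → ℝ) :
    mollify n g =
      ((shrinkingBump n).normed volume ⋆[ContinuousLinearMap.lsmul ℝ ℝ, volume] g) := by
  ext x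
  rw [convolution_eq_swap]
  refine integral_congr_ae (Filter.Eventually.of_forall fun y => ?_)
  simp only [ContinuousLinearMap.lsmul_apply, smul_eq_mul]
  rw [← neg_sub y x, ContDiffBump.normed_neg, mul_comm]

theorem continuous_mollify (n : ℕ) {g : ℝ → ℝ} (hg : Integrable g) :
    Continuous (mollify n g) := by
  rw [mollify_eq_convolution]
  exact (shrinkingBump n).hasCompactSupport_normed.continuous_convolution_left _
    (shrinkingBump n).continuous_normed hg.locallyIntegrable

open Filter Topology in
theorem ae_tendsto_mollify {g : ℝ → ℝ} (hg : Integrable g) :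
    ∀ᵐ x, Tendsto (fun n => mollify n g x) atTop (𝓝 (g x)) := by
  simp only [mollify_eq_convolution]
  refine ContDiffBump.ae_convolution_tendsto_right_of_locallyIntegrable (K := 2)
    tendsto_shrinkingBump_rOut (Eventually.of_forall fun n => le_of_eq ?_) hg.locallyIntegrable
  simp only [shrinkingBump]
  ring

/-- The derivative of a plateau is a bump at `α` minus a bump at `β`. This turns information from
plateau test functions into a comparison of pointwise values, after `n → ∞`. -/
theorem mollify_sub_mollify (n : ℕ) {a b : ℝ} {g : ℝ → ℝ} (hg : IntegrableOn g (Ioo a b))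
    (α β : ℝ) :
    mollify n ((Ioo a b).indicator g) α - mollify n ((Ioo a b).indicator g) β =
      ∫ x in Ioo a b, g x * deriv (plateau (shrinkingBump n) α β) x := by
  have hgi : Integrable ((Ioo a b).indicator g) := hg.integrable_indicator measurableSet_Ioo
  have hi : ∀ γ, Integrable fun y =>
      (Ioo a b).indicator g y * (shrinkingBump n).normed volume (y - γ) := by
    intro γ
    have hc : Continuous fun y => (shrinkingBump n).normed volume (y - γ) :=
      (shrinkingBump n).continuous_normed.comp (continuous_id.sub continuous_const)
    obtain ⟨C, hC⟩ := (shrinkingBump n).hasCompactSupport_normed (μ := volume)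
      |>.exists_bound_of_continuous (shrinkingBump n).continuous_normed
    exact hgi.mul_bdd hc.aestronglyMeasurable (Filter.Eventually.of_forall fun y => hC (y - γ))
  rw [mollify, mollify, ← integral_sub (hi α) (hi β), ← integral_indicator measurableSet_Ioo]
  refine integral_congr_ae (Filter.Eventually.of_forall fun x => ?_)
  simp only [plateau.deriv_eq, indicator_apply]
  split_ifs <;> ring

/-! ### Constancy of the flux on saturated intervals -/

/-- Let `J` be orthogonal to the derivative of every plateau function on which the density `σ` is
saturated. Then `J`, extended by zero outside `(a, b)`, is constant on every interval on which `σ`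
is saturated. The interval may reach beyond `(a, b)`. -/
theorem ae_const_of_saturated {a b : ℝ} {J σ : ℝ → ℝ} (hJ : IntegrableOn J (Ioo a b))
    (h : ∀ (n : ℕ) (α β : ℚ), α < β →
      ∫ x in Ioo a b, σ x * plateau (shrinkingBump n) α β x =
        ∫ x in Ioo a b, plateau (shrinkingBump n) α β x →
      ∫ x in Ioo a b, J x * deriv (plateau (shrinkingBump n) α β) x = 0)
    {l r : ℝ} (hlr : l < r) (hσ : ∀ᵐ x, x ∈ Ioo l r → x ∈ Ioo a b → σ x = 1) :
    ∃ c, ∀ᵐ x, x ∈ Ioo l r → (Ioo a b).indicator J x = c := by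
  set K : ℕ → ℝ → ℝ := fun n => mollify n ((Ioo a b).indicator J) with hK
  set ε : ℕ → ℝ := fun n => (shrinkingBump n).rOut with hε
  have hJi : Integrable ((Ioo a b).indicator J) := hJ.integrable_indicator measurableSet_Ioo
  -- The margin `ε n` keeps the support of the plateau inside `(l, r)`, where `σ` is saturated.
  have hlt : ∀ n (α β : ℚ), (α : ℝ) ∈ Ioo (l + ε n) (r - ε n) →
      (β : ℝ) ∈ Ioo (l + ε n) (r - ε n) → α < β → K n α = K n β := by
    intro n α β hα hβ hαβ
    rw [← sub_eq_zero, hK, mollify_sub_mollify n hJ]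
    apply h n α β hαβ
    have hαβ' : (α : ℝ) ≤ β := by exact_mod_cast hαβ.le
    apply integral_congr_ae
    rw [Filter.EventuallyEq, ae_restrict_iff' measurableSet_Ioo]
    filter_upwards [hσ] with x hx hxab
    by_cases hxl : x ∈ Ioo l r
    · rw [hx hxl hxab, one_mul]
    · have : plateau (shrinkingBump n) α β x = 0 := by
        rw [mem_Ioo, not_and_or, not_lt, not_lt] at hxl
        rcases hxl with hxl | hxl
        · exact plateau.eq_zero_left _ hαβ' (by linarith [hα.1])
        · exact plateau.eq_zero_right _ hαβ' (by linarith [hβ.2])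
      rw [this, mul_zero]
  have hrat : ∀ n (α β : ℚ), (α : ℝ) ∈ Ioo (l + ε n) (r - ε n) →
      (β : ℝ) ∈ Ioo (l + ε n) (r - ε n) → K n α = K n β := by
    intro n α β hα hβ
    rcases lt_trichotomy α β with h1 | h1 | h1
    · exact hlt n α β hα hβ h1
    · rw [h1]
    · exact (hlt n β α hβ hα h1).symm
  -- From rational to real points, by continuity of the mollification.
  have hext : ∀ n (c : ℝ), (∀ α : ℚ, (α : ℝ) ∈ Ioo (l + ε n) (r - ε n) → K n α = c) →
      ∀ x ∈ Ioo (l + ε n) (r - ε n), K n x = c := by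
    intro n c hc x hx
    have hcl : IsClosed {y | K n y = c} :=
      isClosed_eq (continuous_mollify n hJi) continuous_const
    have hd := (Rat.denseRange_cast (𝕜 := ℝ)).open_subset_closure_inter
      (isOpen_Ioo (a := l + ε n) (b := r - ε n))
    refine closure_minimal ?_ hcl (hd hx)
    rintro y ⟨hy, α, rfl⟩
    exact hc α hy
  have hall : ∀ n, ∀ x ∈ Ioo (l + ε n) (r - ε n), ∀ y ∈ Ioo (l + ε n) (r - ε n),
      K n x = K n y := fun n x hx y hy =>
    (hext n _ (fun α hα => hext n _ (fun β hβ => hrat n β α hβ hα) y hy |>.symm) x hx)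
  have hev : ∀ x ∈ Ioo l r, ∀ᶠ n in Filter.atTop, x ∈ Ioo (l + ε n) (r - ε n) := by
    intro x hx
    filter_upwards [tendsto_shrinkingBump_rOut.eventually_lt_const (sub_pos.2 hx.1),
      tendsto_shrinkingBump_rOut.eventually_lt_const (sub_pos.2 hx.2)] with n h1 h2
    exact ⟨by linarith, by linarith⟩
  have hae := ae_tendsto_mollify hJi
  -- A point of convergence `x₀` supplies the constant: `K n x = K n x₀` for large `n` passes to the
  -- limit.
  obtain ⟨x₀, hx₀, hx₀I⟩ : ∃ x₀, Filter.Tendsto (fun n => K n x₀) Filter.atTop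
      (nhds ((Ioo a b).indicator J x₀)) ∧ x₀ ∈ Ioo l r := by
    by_contra! hc
    have : volume (Ioo l r) = 0 := by
      refine measure_mono_null ?_ hae
      exact fun x hx hx' => hc x hx' hx
    rw [Real.volume_Ioo, ENNReal.ofReal_eq_zero] at this
    linarith
  refine ⟨(Ioo a b).indicator J x₀, hae.mono fun x hx hxI => ?_⟩
  refine tendsto_nhds_unique hx (hx₀.congr' ?_)
  filter_upwards [hev x hxI, hev x₀ hx₀I] with n h1 h2 using hall n _ h2 _ h1

/-! ### Weak derivatives and primitives -/

open Filter Topology in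
/-- A function with an integrable weak derivative is almost everywhere a primitive of it. -/
theorem HasWeakDeriv.exists_primitive {a b : ℝ} (hab : a < b) {p q : ℝ → ℝ}
    (hp : IntegrableOn p (Ioo a b)) (hq : IntegrableOn q (Ioo a b)) (h : HasWeakDeriv a b p q) :
    ∃ c, ∀ᵐ x, x ∈ Ioo a b → p x = c + ∫ y in a..x, (Ioo a b).indicator q y := by
  have hpi : Integrable ((Ioo a b).indicator p) := hp.integrable_indicator measurableSet_Ioo
  have hqi : Integrable ((Ioo a b).indicator q) := hq.integrable_indicator measurableSet_Ioo
  have hae := ae_tendsto_mollify hpi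
  have key : ∀ α ∈ Ioo a b, ∀ β ∈ Ioo a b, α < β →
      Tendsto (fun n => mollify n ((Ioo a b).indicator p) α) atTop (𝓝 ((Ioo a b).indicator p α)) →
      Tendsto (fun n => mollify n ((Ioo a b).indicator p) β) atTop (𝓝 ((Ioo a b).indicator p β)) →
      p β - p α = ∫ y in α..β, (Ioo a b).indicator q y := by
    intro α hα β hβ hαβ hlα hlβ
    rw [indicator_of_mem hα] at hlα
    rw [indicator_of_mem hβ] at hlβ
    have hlim : Tendsto (fun n => ∫ x in Ioo a b, q x * plateau (shrinkingBump n) α β x) atTop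
        (𝓝 (∫ x in Ioo a b, (Ioc α β).indicator q x)) := by
      refine tendsto_integral_of_dominated_convergence (fun x => |q x|) ?_ hq.abs ?_ ?_
      · exact fun n => hq.aestronglyMeasurable.mul
          (plateau.contDiff _ α β).continuous.aestronglyMeasurable
      · refine fun n => Eventually.of_forall fun x => ?_
        rw [norm_mul, Real.norm_eq_abs, Real.norm_eq_abs,
          abs_of_nonneg (plateau.nonneg _ hαβ.le x)]
        exact mul_le_of_le_one_right (abs_nonneg _) (plateau.le_one _ _ _ _)
      -- The plateaus tend to the indicator of `(α, β]` except at the two endpoints.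
      · have hne : ∀ᵐ x ∂volume.restrict (Ioo a b), x ≠ α ∧ x ≠ β :=
          (Measure.ae_ne _ α).and (Measure.ae_ne _ β)
        filter_upwards [hne] with x hx
        apply tendsto_const_nhds.congr'
        by_cases hxI : x ∈ Ioc α β
        · have h1 : 0 < x - α := sub_pos.2 hxI.1
          have h2 : 0 < β - x := sub_pos.2 (lt_of_le_of_ne hxI.2 hx.2)
          filter_upwards [tendsto_shrinkingBump_rOut.eventually_lt_const h1,
            tendsto_shrinkingBump_rOut.eventually_lt_const h2] with n hn1 hn2
          rw [indicator_of_mem hxI, plateau.eq_one _ (by linarith) (by linarith), mul_one]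
        · rw [indicator_of_notMem hxI]
          rw [mem_Ioc, not_and_or, not_lt, not_le] at hxI
          rcases hxI with hxI | hxI
          · have h1 : 0 < α - x := sub_pos.2 (lt_of_le_of_ne hxI hx.1)
            filter_upwards [tendsto_shrinkingBump_rOut.eventually_lt_const h1] with n hn1
            rw [plateau.eq_zero_left _ hαβ.le (by linarith), mul_zero]
          · filter_upwards [tendsto_shrinkingBump_rOut.eventually_lt_const (sub_pos.2 hxI)]
              with n hn1
            rw [plateau.eq_zero_right _ hαβ.le (by linarith), mul_zero]
    have heq : (fun n => -(mollify n ((Ioo a b).indicator p) α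
        - mollify n ((Ioo a b).indicator p) β)) =ᶠ[atTop]
        fun n => ∫ x in Ioo a b, q x * plateau (shrinkingBump n) α β x := by
      -- For large `n` the plateau is supported inside `(a, b)`, hence admissible in the weak
      -- derivative.
      filter_upwards [tendsto_shrinkingBump_rOut.eventually_lt_const (sub_pos.2 hα.1),
        tendsto_shrinkingBump_rOut.eventually_lt_const (sub_pos.2 hβ.2)] with n hn1 hn2
      rw [mollify_sub_mollify n hp, h _ (plateau.isTestFunction _ hαβ.le (by linarith)
        (by linarith)), neg_neg]
    have := tendsto_nhds_unique ((hlα.sub hlβ).neg.congr' heq) hlim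
    rw [neg_sub] at this
    rw [this, intervalIntegral.integral_of_le hαβ.le, ← integral_indicator measurableSet_Ioo,
      ← integral_indicator measurableSet_Ioc, indicator_indicator, indicator_indicator, inter_comm]
  obtain ⟨x₀, hx₀, hx₀I⟩ : ∃ x₀, Tendsto (fun n => mollify n ((Ioo a b).indicator p) x₀) atTop
      (𝓝 ((Ioo a b).indicator p x₀)) ∧ x₀ ∈ Ioo a b := by
    by_contra! hc
    have : volume (Ioo a b) = 0 := by
      refine measure_mono_null ?_ hae
      exact fun x hx hx' => hc x hx' hx
    rw [Real.volume_Ioo, ENNReal.ofReal_eq_zero] at this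
    linarith
  refine ⟨p x₀ - ∫ y in a..x₀, (Ioo a b).indicator q y, hae.mono fun x hx hxI => ?_⟩
  have hadd := intervalIntegral.integral_add_adjacent_intervals
    (hqi.intervalIntegrable (a := a) (b := x₀)) (hqi.intervalIntegrable (a := x₀) (b := x))
  rcases lt_trichotomy x x₀ with h1 | h1 | h1
  · have := key x hxI x₀ hx₀I h1 hx hx₀
    rw [intervalIntegral.integral_symm x x₀] at hadd
    linarith
  · rw [h1]; ring
  · have := key x₀ hx₀I x hxI h1 hx₀ hx
    linarith

/-! ### The gradient bound -/

theorem eq_of_ae_eq_const {l r c d : ℝ} {f : ℝ → ℝ} (hlr : l < r)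
    (hc : ∀ᵐ x, x ∈ Ioo l r → f x = c) (hd : ∀ x ∈ Ioo l r, f x = d) : c = d := by
  by_contra hne
  have : volume (Ioo l r) = 0 := by
    refine measure_mono_null ?_ hc
    exact fun x hx hx' => hne ((hx' hx).symm.trans (hd x hx))
  rw [Real.volume_Ioo, ENNReal.ofReal_eq_zero] at this
  linarith

/-- The positivity interval of a continuous function to the left of a point of `(a, b)`: it
reaches beyond `a` or ends at a zero. -/
theorem exists_left_end {a x₀ : ℝ} {u : ℝ → ℝ} (hu : Continuous u) (hx₀ : a < x₀)
    (hpos : 0 < u x₀) (hnn : ∀ x, a < x → x ≤ x₀ → 0 ≤ u x) :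
    ∃ l < x₀, (∀ x, l < x → a < x → x ≤ x₀ → 0 < u x) ∧ (l < a ∨ a ≤ l ∧ u l = 0) := by
  -- The largest zero in `[a, x₀]` is the end, a zero at `a` included. Without a zero, any point
  -- below `a` serves, such as `a - 1`.
  by_cases h : ({x | u x = 0} ∩ Icc a x₀).Nonempty
  · have hcomp : IsCompact ({x | u x = 0} ∩ Icc a x₀) :=
      isCompact_Icc.inter_left (isClosed_eq hu continuous_const)
    obtain ⟨l, ⟨hl0, hlI⟩, hmax⟩ := hcomp.exists_isGreatest h
    refine ⟨l, lt_of_le_of_ne hlI.2 ?_, fun x hlx hax hx => ?_, Or.inr ⟨hlI.1, hl0⟩⟩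
    · rintro rfl
      exact hpos.ne' hl0
    · refine lt_of_le_of_ne (hnn x hax hx) fun h0 => ?_
      exact absurd (hmax ⟨h0.symm, hax.le, hx⟩) (not_le.2 hlx)
  · refine ⟨a - 1, by linarith, fun x _ hax hx => ?_, Or.inl (by linarith)⟩
    exact lt_of_le_of_ne (hnn x hax hx) fun h0 => h ⟨x, h0.symm, hax.le, hx⟩

/-- The mirror image of `exists_left_end` under `x ↦ -x`. -/
theorem exists_right_end {b x₀ : ℝ} {u : ℝ → ℝ} (hu : Continuous u) (hx₀ : x₀ < b)
    (hpos : 0 < u x₀) (hnn : ∀ x, x < b → x₀ ≤ x → 0 ≤ u x) :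
    ∃ r > x₀, (∀ x, x < r → x < b → x₀ ≤ x → 0 < u x) ∧ (b < r ∨ r ≤ b ∧ u r = 0) := by
  obtain ⟨l, hl, h1, h2⟩ := exists_left_end (u := fun x => u (-x)) (a := -b) (x₀ := -x₀)
    (hu.comp continuous_neg) (by linarith) (by simpa using hpos)
    (fun x h1 h2 => hnn (-x) (by linarith) (by linarith))
  refine ⟨-l, by linarith, fun x hx hb hx₀ => ?_, ?_⟩
  · simpa using h1 (-x) (by linarith) (by linarith) (by linarith)
  · rcases h2 with h2 | ⟨h2, h3⟩
    · exact Or.inl (by linarith)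
    · exact Or.inr ⟨by linarith, h3⟩

theorem integral_sub_eq_primitive {q : ℝ → ℝ} (hq : Integrable q) (a c x y : ℝ) :
    (c + ∫ s in a..y, q s) - (c + ∫ s in a..x, q s) = ∫ s in x..y, q s := by
  have := intervalIntegral.integral_add_adjacent_intervals
    (hq.intervalIntegrable (a := a) (b := x)) (hq.intervalIntegrable (a := x) (b := y))
  linarith

/-- Let `u ≥ 0` have derivative `q` on `(a, b)`, and let `q + g`, extended by zero, be constant on
the intervals on which `u > 0`, where `|g| ≤ L`. Then `|q| ≤ 2 L`. -/
theorem ae_abs_le_of_flux_const {a b L c₀ : ℝ} (hL : 0 ≤ L) {q g J u : ℝ → ℝ}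
    (hq : IntegrableOn q (Ioo a b))
    (hu : ∀ x, u x = c₀ + ∫ s in a..x, (Ioo a b).indicator q s)
    (hnn : ∀ x ∈ Ioo a b, 0 ≤ u x)
    (hg : ∀ᵐ x, x ∈ Ioo a b → 0 < u x → |g x| ≤ L)
    (hJg : ∀ᵐ x, x ∈ Ioo a b → 0 < u x → J x = q x + g x)
    (hJ : ∀ l r, l < r → (∀ x ∈ Ioo l r, x ∈ Ioo a b → 0 < u x) →
      ∃ c, ∀ᵐ x, x ∈ Ioo l r → (Ioo a b).indicator J x = c) :
    ∀ᵐ x, |(Ioo a b).indicator q x| ≤ 2 * L := by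
  have hqi : Integrable ((Ioo a b).indicator q) := hq.integrable_indicator measurableSet_Ioo
  have huf : u = fun x => c₀ + ∫ s in a..x, (Ioo a b).indicator q s := funext hu
  have hcont : Continuous u := by
    rw [huf]
    exact continuous_const.add (intervalIntegral.continuous_primitive
      (fun _ _ => hqi.intervalIntegrable) a)
  -- A zero of `u ≥ 0` is an interior minimum, so `u' = q` vanishes there at almost every such
  -- point.
  have hzero : ∀ᵐ x, x ∈ Ioo a b → u x = 0 → q x = 0 := by
    filter_upwards [LocallyIntegrable.ae_hasDerivAt_integral hqi.locallyIntegrable] with x hx hxI h0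
    have hd : HasDerivAt u ((Ioo a b).indicator q x) x := by
      rw [huf]
      exact (hx a).const_add c₀
    have hmin : IsLocalMin u x := by
      filter_upwards [isOpen_Ioo.mem_nhds hxI] with y hy
      rw [h0]
      exact hnn y hy
    rw [← hmin.hasDerivAt_eq_zero hd, indicator_of_mem hxI]
  have hpos : volume {x | x ∈ Ioo a b ∧ 0 < u x ∧ 2 * L < |q x|} = 0 := by
    -- Being null is a local property, so one component `(l, r)` of `{u > 0}` can be treated at a
    -- time.
    refine measure_null_of_locally_null _ ?_
    rintro x₀ ⟨hx₀, hux₀, -⟩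
    obtain ⟨l, hl, hl1, hl2⟩ := exists_left_end hcont hx₀.1 hux₀
      (fun x h1 h2 => hnn x ⟨h1, h2.trans_lt hx₀.2⟩)
    obtain ⟨r, hr, hr1, hr2⟩ := exists_right_end hcont hx₀.2 hux₀
      (fun x h1 h2 => hnn x ⟨hx₀.1.trans_le h2, h1⟩)
    have hpI : ∀ x ∈ Ioo l r, x ∈ Ioo a b → 0 < u x := by
      intro x hx hxab
      rcases le_total x x₀ with h | h
      · exact hl1 x hx.1 hxab.1 h
      · exact hr1 x hx.2 hxab.2 h
    obtain ⟨c, hc⟩ := hJ l r (hl.trans hr) hpI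
    have hqc : ∀ᵐ x, x ∈ Ioo l r → x ∈ Ioo a b → |c - q x| ≤ L := by
      filter_upwards [hc, hg, hJg] with x h1 h2 h3 hx hxab
      have h4 := h1 hx
      rw [indicator_of_mem hxab, h3 hxab (hpI x hx hxab)] at h4
      rw [← h4, add_sub_cancel_left]
      exact h2 hxab (hpI x hx hxab)
    -- If `(l, r)` sticks out of `(a, b)`, the constant is read off outside, where the extended flux
    -- is zero. Otherwise `u l = u r = 0`, so `q` has integral zero and `c` is the mean of `c - q`.
    have hcL : |c| ≤ L := by
      rcases hl2 with hla | ⟨hla, hul⟩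
      · have : c = 0 := eq_of_ae_eq_const (lt_min hla (hl.trans hr))
          (hc.mono fun x hx hxI => hx ⟨hxI.1, hxI.2.trans_le (min_le_right _ _)⟩)
          (fun x hx => indicator_of_notMem
            (fun h => absurd h.1 (not_lt.2 (hx.2.trans_le (min_le_left _ _)).le)) J)
        simpa [this] using hL
      rcases hr2 with hrb | ⟨hrb, hur⟩
      · have : c = 0 := eq_of_ae_eq_const (max_lt hrb (hl.trans hr))
          (hc.mono fun x hx hxI => hx ⟨(le_max_right _ _).trans_lt hxI.1, hxI.2⟩)
          (fun x hx => indicator_of_notMem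
            (fun h => absurd h.2 (not_lt.2 ((le_max_left _ _).trans_lt hx.1).le)) J)
        simpa [this] using hL
      have hlr : l < r := hl.trans hr
      have h0 : ∫ s in l..r, (Ioo a b).indicator q s = 0 := by
        rw [← integral_sub_eq_primitive hqi a c₀, ← hu, ← hu, hul, hur, sub_zero]
      have h1 : ∫ s in l..r, (c - (Ioo a b).indicator q s) = (r - l) * c := by
        rw [intervalIntegral.integral_sub intervalIntegrable_const hqi.intervalIntegrable, h0,
          intervalIntegral.integral_const, sub_zero, smul_eq_mul]
      have h2 : ‖∫ s in l..r, (c - (Ioo a b).indicator q s)‖ ≤ L * |r - l| := by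
        apply intervalIntegral.norm_integral_le_of_norm_le_const_ae
        filter_upwards [hqc, Measure.ae_ne volume r] with x hx hxr hxI
        rw [uIoc_of_le hlr.le] at hxI
        have hxI' : x ∈ Ioo l r := ⟨hxI.1, lt_of_le_of_ne hxI.2 hxr⟩
        have hxab : x ∈ Ioo a b := ⟨hla.trans_lt hxI'.1, hxI'.2.trans_le hrb⟩
        rw [indicator_of_mem hxab]
        exact hx hxI' hxab
      rw [h1, norm_mul, Real.norm_eq_abs, Real.norm_eq_abs, mul_comm] at h2
      exact le_of_mul_le_mul_right h2 (abs_pos.2 (sub_pos.2 hlr).ne')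
    refine ⟨Ioo l r ∩ {x | x ∈ Ioo a b ∧ 0 < u x ∧ 2 * L < |q x|}, ?_, ?_⟩
    · rw [inter_comm]
      exact inter_mem_nhdsWithin _ (Ioo_mem_nhds hl hr)
    · refine measure_mono_null ?_ hqc
      rintro x ⟨hx, hxab, -, hlt⟩ hle
      have h1 := abs_le.1 (hle hx hxab)
      have h2 := abs_le.1 hcL
      have : |q x| ≤ 2 * L := abs_le.2 ⟨by linarith, by linarith⟩
      exact absurd hlt (not_lt.2 this)
  filter_upwards [hzero, compl_mem_ae_iff.2 hpos] with x h1 h2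
  by_cases hx : x ∈ Ioo a b
  · rw [indicator_of_mem hx]
    rcases (hnn x hx).eq_or_lt with h0 | h0
    · rw [h1 hx h0.symm, abs_zero]
      positivity
    · by_contra! hc
      exact h2 ⟨hx, h0, hc⟩
  · rw [indicator_of_notMem hx, abs_zero]
    positivity

theorem lipschitzOnWith_of_ae_abs_le {C : ℝ≥0} {q u : ℝ → ℝ} {a c₀ : ℝ} (hq : Integrable q)
    (hu : ∀ x, u x = c₀ + ∫ s in a..x, q s) (hC : ∀ᵐ x, |q x| ≤ C) (s : Set ℝ) :
    LipschitzOnWith C u s := by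
  refine LipschitzOnWith.of_dist_le_mul fun x _ y _ => ?_
  rw [Real.dist_eq, Real.dist_eq, hu, hu, integral_sub_eq_primitive hq, ← Real.norm_eq_abs]
  exact intervalIntegral.norm_integral_le_of_norm_le_const_ae (hC.mono fun x hx _ => hx)

/-! ### Locally affine sums: smoothness and the distributional equation -/

/-- Near every point of the open set `U` the sum of `u` and `Φ` is an affine function. -/
def AffineSumOn (U : Set ℝ) (u Φ : ℝ → ℝ) : Prop :=
  ∀ x ∈ U, ∃ k d : ℝ, ∀ᶠ y in nhds x, u y + Φ y = k * y + d

/-- If `q + Φ'` is constant on the intervals on which `ρ = 1`, then the primitive `u` of `q`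
differs from `-Φ` by a locally affine function on the interior of `{ρ = 1}`. -/
theorem affineSumOn_interiorEqOne {a b c₀ : ℝ} {q u Φ ρ : ℝ → ℝ} (hq : IntegrableOn q (Ioo a b))
    (hu : ∀ x, u x = c₀ + ∫ s in a..x, (Ioo a b).indicator q s)
    (hΦ : ContDiffOn ℝ 1 Φ (Ioo a b))
    (hJ : ∀ l r, l < r → Ioo l r ⊆ Ioo a b → (∀ᵐ x, x ∈ Ioo l r → ρ x = 1) →
      ∃ c, ∀ᵐ x, x ∈ Ioo l r → q x + deriv Φ x = c) :
    AffineSumOn (interiorEqOne a b ρ) u Φ := by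
  rintro x ⟨V, ⟨hVo, hVab, hV⟩, hxV⟩
  have hqi : Integrable ((Ioo a b).indicator q) := hq.integrable_indicator measurableSet_Ioo
  obtain ⟨l, r, hx, hlr⟩ := (mem_nhds_iff_exists_Ioo_subset).1 (hVo.mem_nhds hxV)
  rw [ae_restrict_iff' hVo.measurableSet] at hV
  obtain ⟨c, hc⟩ := hJ l r (hx.1.trans hx.2) (hlr.trans hVab) (hV.mono fun y hy hyI => hy (hlr hyI))
  refine ⟨c, u x + Φ x - c * x, ?_⟩
  filter_upwards [Ioo_mem_nhds hx.1 hx.2] with y hy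
  have hsub : uIcc x y ⊆ Ioo l r := ordConnected_Ioo.uIcc_subset hx hy
  have hsub' : uIcc x y ⊆ Ioo a b := hsub.trans (hlr.trans hVab)
  have hdc : ContinuousOn (deriv Φ) (Ioo a b) := hΦ.continuousOn_deriv_of_isOpen isOpen_Ioo le_rfl
  have hint : IntervalIntegrable (deriv Φ) volume x y := (hdc.mono hsub').intervalIntegrable
  have hftc : ∫ s in x..y, deriv Φ s = Φ y - Φ x :=
    intervalIntegral.integral_deriv_eq_sub (fun s hs =>
      (hΦ.differentiableOn one_ne_zero).differentiableAt (isOpen_Ioo.mem_nhds (hsub' hs))) hint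
  have hsum : ∫ s in x..y, ((Ioo a b).indicator q s + deriv Φ s) = ∫ _s in x..y, c := by
    apply intervalIntegral.integral_congr_ae
    filter_upwards [hc] with s hs hsI
    have hs' := uIoc_subset_uIcc hsI
    rw [indicator_of_mem (hsub' hs')]
    exact hs (hsub hs')
  rw [intervalIntegral.integral_add hqi.intervalIntegrable hint, hftc,
    intervalIntegral.integral_const, ← integral_sub_eq_primitive hqi a c₀, ← hu, ← hu,
    smul_eq_mul] at hsum
  linarith

theorem AffineSumOn.isAsSmoothAsOn {U : Set ℝ} {u Φ : ℝ → ℝ} (h : AffineSumOn U u Φ) :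
    IsAsSmoothAsOn U u Φ := by
  intro x hx n hn
  obtain ⟨k, d, hk⟩ := h x hx
  have hs : ContDiffAt ℝ n (fun y => k * y + d - Φ y) x :=
    ((contDiffAt_const.mul contDiffAt_id).add contDiffAt_const).sub hn
  refine hs.congr_of_eventuallyEq ?_
  filter_upwards [hk] with y hy
  linarith

/-- The integral of the derivative of a compactly supported function vanishes. -/
theorem integral_deriv_eq_zero_of_hasCompactSupport {f f' : ℝ → ℝ} (hf : ∀ x, HasDerivAt f (f' x) x)
    (hc : Continuous f') (hs : HasCompactSupport f) : ∫ x, f' x = 0 := by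
  have hf' : f' = deriv f := funext fun x => (hf x).deriv.symm
  have hs' : HasCompactSupport f' := hf' ▸ hs.deriv
  have hcf : Continuous f := continuous_iff_continuousAt.2 fun x => (hf x).continuousAt
  exact integral_eq_zero_of_hasDerivAt_of_integrable hf (hc.integrable_of_hasCompactSupport hs')
    (hcf.integrable_of_hasCompactSupport hs)

/-- A locally affine function on `U` is annihilated by `φ''`. -/
theorem AffineSumOn.integral_eq_zero {U : Set ℝ} {u Φ φ : ℝ → ℝ} (h : AffineSumOn U u Φ)
    (hφ : IsTestFunction U φ) : ∫ x, (u x + Φ x) * iteratedDeriv 2 φ x = 0 := by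
  obtain ⟨hφs, hφc, hφU⟩ := hφ
  have h2 : iteratedDeriv 2 φ = deriv (deriv φ) := by
    rw [iteratedDeriv_succ, iteratedDeriv_one]
  have hd1 : ContDiff ℝ ∞ (deriv φ) := (contDiff_infty_iff_deriv.1 hφs).2
  have hd2 : ContDiff ℝ ∞ (deriv (deriv φ)) := (contDiff_infty_iff_deriv.1 hd1).2
  have ht1 : tsupport (deriv φ) ⊆ tsupport φ := closure_minimal support_deriv_subset isClosed_closure
  have ht2 : tsupport (deriv (deriv φ)) ⊆ tsupport φ :=
    (closure_minimal support_deriv_subset isClosed_closure).trans ht1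
  set w : ℝ → ℝ := fun x => u x + Φ x with hw
  have hloc : ∀ x ∈ U, ∃ k, (∀ᶠ y in nhds x, deriv w y = k) ∧ HasDerivAt w k x := by
    intro x hx
    obtain ⟨k, d, hk⟩ := h x hx
    have haff : ∀ y, HasDerivAt (fun y => k * y + d) k y := fun y => by
      simpa using ((hasDerivAt_id y).const_mul k).add_const d
    refine ⟨k, ?_, (haff x).congr_of_eventuallyEq hk⟩
    filter_upwards [hk.eventually_nhds] with y hy
    exact ((haff y).congr_of_eventuallyEq hy).deriv
  have hout : ∀ {x}, x ∉ tsupport φ → ∀ᶠ y in nhds x, φ y = 0 ∧ deriv φ y = 0 ∧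
      deriv (deriv φ) y = 0 := by
    intro x hx
    filter_upwards [isClosed_closure.isOpen_compl.mem_nhds hx] with y hy
    exact ⟨image_eq_zero_of_notMem_tsupport hy,
      image_eq_zero_of_notMem_tsupport fun hc => hy (ht1 hc),
      image_eq_zero_of_notMem_tsupport fun hc => hy (ht2 hc)⟩
  have hdφ : ∀ x, HasDerivAt φ (deriv φ x) x := fun x =>
    ((contDiff_infty_iff_deriv.1 hφs).1 x).hasDerivAt
  have hdφ' : ∀ x, HasDerivAt (deriv φ) (deriv (deriv φ) x) x := fun x =>
    ((contDiff_infty_iff_deriv.1 hd1).1 x).hasDerivAt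
  -- Two integrations by parts: `w φ'' = (w φ')' - w' φ'`, and `w' φ' = (w' φ)'` because `w'` is
  -- locally constant on `U`. Off the support of `φ` everything vanishes.
  have hD1 : ∀ x, HasDerivAt (fun x => deriv w x * φ x) (deriv w x * deriv φ x) x := by
    intro x
    by_cases hx : x ∈ tsupport φ
    · obtain ⟨k, hk, -⟩ := hloc x (hφU hx)
      rw [hk.self_of_nhds]
      refine ((hdφ x).const_mul k).congr_of_eventuallyEq ?_
      filter_upwards [hk] with y hy
      rw [hy]
    · rw [(hout hx).self_of_nhds.2.1, mul_zero]
      refine (hasDerivAt_const x (0 : ℝ)).congr_of_eventuallyEq ?_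
      filter_upwards [hout hx] with y hy
      rw [hy.1, mul_zero]
  have hD2 : ∀ x, HasDerivAt (fun x => w x * deriv φ x)
      (deriv w x * deriv φ x + w x * deriv (deriv φ) x) x := by
    intro x
    by_cases hx : x ∈ tsupport φ
    · obtain ⟨k, hk, hk'⟩ := hloc x (hφU hx)
      rw [hk.self_of_nhds]
      exact hk'.mul (hdφ' x)
    · rw [(hout hx).self_of_nhds.2.1, (hout hx).self_of_nhds.2.2, mul_zero, mul_zero, add_zero]
      refine (hasDerivAt_const x (0 : ℝ)).congr_of_eventuallyEq ?_
      filter_upwards [hout hx] with y hy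
      rw [hy.2.1, mul_zero]
  have hC1 : Continuous fun x => deriv w x * deriv φ x := by
    rw [continuous_iff_continuousAt]
    intro x
    by_cases hx : x ∈ tsupport φ
    · obtain ⟨k, hk, -⟩ := hloc x (hφU hx)
      refine (continuousAt_const.mul hd1.continuous.continuousAt).congr (f := fun x => k * deriv φ x) ?_
      filter_upwards [hk] with y hy
      rw [hy]
    · refine (continuousAt_const (y := (0 : ℝ))).congr ?_
      filter_upwards [hout hx] with y hy
      rw [hy.2.1, mul_zero]
  have hC2 : Continuous fun x => w x * deriv (deriv φ) x := by
    rw [continuous_iff_continuousAt]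
    intro x
    by_cases hx : x ∈ tsupport φ
    · obtain ⟨k, -, hk⟩ := hloc x (hφU hx)
      exact hk.continuousAt.mul hd2.continuous.continuousAt
    · refine (continuousAt_const (y := (0 : ℝ))).congr ?_
      filter_upwards [hout hx] with y hy
      rw [hy.2.2, mul_zero]
  have hs1 : HasCompactSupport fun x => deriv w x * φ x := hφc.mul_left
  have hs2 : HasCompactSupport fun x => w x * deriv φ x := hφc.deriv.mul_left
  have i1 := integral_deriv_eq_zero_of_hasCompactSupport hD1 hC1 hs1
  have i2 := integral_deriv_eq_zero_of_hasCompactSupport hD2 (hC1.add hC2) hs2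
  rw [integral_add (hC1.integrable_of_hasCompactSupport hφc.deriv.mul_left)
    (hC2.integrable_of_hasCompactSupport hφc.deriv.deriv.mul_left), i1, zero_add] at i2
  rw [h2]
  exact i2

theorem AffineSumOn.negSecondDerivEqOn {U : Set ℝ} {u Φ : ℝ → ℝ} (h : AffineSumOn U u Φ)
    (hu : ContinuousOn u U) (hΦ : ContinuousOn Φ U) (hU : IsOpen U) :
    NegSecondDerivEqOn U u Φ := by
  intro φ hφ
  have h0 := h.integral_eq_zero hφ
  obtain ⟨hφs, hφc, hφU⟩ := hφ
  have h2 : iteratedDeriv 2 φ = deriv (deriv φ) := by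
    rw [iteratedDeriv_succ, iteratedDeriv_one]
  have hd2 : ContDiff ℝ ∞ (deriv (deriv φ)) :=
    (contDiff_infty_iff_deriv.1 (contDiff_infty_iff_deriv.1 hφs).2).2
  have ht : tsupport (iteratedDeriv 2 φ) ⊆ tsupport φ := by
    rw [h2]
    exact (closure_minimal support_deriv_subset isClosed_closure).trans
      (closure_minimal support_deriv_subset isClosed_closure)
  have hout : ∀ x ∉ U, iteratedDeriv 2 φ x = 0 := fun x hx =>
    image_eq_zero_of_notMem_tsupport fun hc => hx (hφU (ht hc))
  -- Nothing is known of `f` outside `U`, but the factor `φ''` makes the product continuous on the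
  -- whole line.
  have hint : ∀ f : ℝ → ℝ, ContinuousOn f U → Integrable fun x => f x * iteratedDeriv 2 φ x := by
    intro f hf
    refine Continuous.integrable_of_hasCompactSupport ?_
      (by rw [h2]; exact hφc.deriv.deriv.mul_left)
    rw [continuous_iff_continuousAt]
    intro x
    by_cases hx : x ∈ tsupport φ
    · refine (hf.continuousAt (hU.mem_nhds (hφU hx))).mul ?_
      rw [h2]
      exact hd2.continuous.continuousAt
    · refine (continuousAt_const (y := (0 : ℝ))).congr ?_
      filter_upwards [isClosed_closure.isOpen_compl.mem_nhds hx] with y hy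
      rw [image_eq_zero_of_notMem_tsupport fun hc => hy (ht hc), mul_zero]
  rw [setIntegral_eq_integral_of_forall_compl_eq_zero (fun x hx => by rw [hout x hx, mul_zero]),
    setIntegral_eq_integral_of_forall_compl_eq_zero (fun x hx => by rw [hout x hx, mul_zero])]
  simp only [add_mul] at h0
  rw [integral_add (hint u hu) (hint Φ hΦ)] at h0
  linarith

/-! ### The continuity equation on the space-time cylinder -/

theorem plateau.continuous_deriv (k : ContDiffBump (0 : ℝ)) (α β : ℝ) :
    Continuous (deriv (plateau k α β)) :=
  (contDiff_infty_iff_deriv.1 (plateau.contDiff k α β)).2.continuous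

theorem plateau.exists_abs_deriv_le (k : ContDiffBump (0 : ℝ)) (α β : ℝ) :
    ∃ C, ∀ x, ‖deriv (plateau k α β) x‖ ≤ C := by
  obtain ⟨C, hC⟩ := k.hasCompactSupport_normed (μ := volume)
    |>.exists_bound_of_continuous k.continuous_normed
  refine ⟨C + C, fun x => ?_⟩
  rw [plateau.deriv_eq]
  exact (norm_sub_le _ _).trans (add_le_add (hC _) (hC _))

theorem cylinderMeasure_eq_prod (T a b : ℝ) :
    cylinderMeasure T a b = (volume.restrict (Icc 0 T)).prod (volume.restrict (Ioo a b)) := by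
  rw [cylinderMeasure, Measure.prod_restrict]
  rfl

instance (T a b : ℝ) : IsFiniteMeasure (cylinderMeasure T a b) := by
  rw [cylinderMeasure_eq_prod]
  infer_instance

theorem ae_slice_of_ae_cylinder {T a b : ℝ} {P : ℝ × ℝ → Prop}
    (h : ∀ᵐ z ∂cylinderMeasure T a b, P z) :
    ∀ᵐ t ∂volume.restrict (Icc 0 T), ∀ᵐ x, x ∈ Ioo a b → P (t, x) := by
  rw [cylinderMeasure_eq_prod] at h
  filter_upwards [Measure.ae_ae_of_ae_prod h] with t ht
  rwa [ae_restrict_iff' measurableSet_Ioo] at ht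

theorem ae_integrableOn_slice {T a b : ℝ} {f : ℝ × ℝ → ℝ} (h : Integrable f (cylinderMeasure T a b)) :
    ∀ᵐ t ∂volume.restrict (Icc 0 T), IntegrableOn (fun x => f (t, x)) (Ioo a b) := by
  rw [cylinderMeasure_eq_prod] at h
  exact h.prod_right_ae

theorem integrable_mul_deriv_plateau {T a b : ℝ} {J : ℝ → ℝ → ℝ}
    (hJ : Integrable (fun z : ℝ × ℝ => J z.1 z.2) (cylinderMeasure T a b))
    (k : ContDiffBump (0 : ℝ)) (α β : ℝ) :
    Integrable (fun z : ℝ × ℝ => J z.1 z.2 * deriv (plateau k α β) z.2)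
      (cylinderMeasure T a b) := by
  obtain ⟨C, hC⟩ := plateau.exists_abs_deriv_le k α β
  exact hJ.mul_bdd ((plateau.continuous_deriv k α β).comp continuous_snd).aestronglyMeasurable
    (Filter.Eventually.of_forall fun z => hC z.2)

theorem integrableOn_integral_slice {T a b : ℝ} {f : ℝ × ℝ → ℝ}
    (h : Integrable f (cylinderMeasure T a b)) :
    IntegrableOn (fun t => ∫ x in Ioo a b, f (t, x)) (Icc 0 T) := by
  rw [cylinderMeasure_eq_prod] at h
  exact h.integral_prod_left

/-- The continuity equation `∂ₜσ = ∂ₓJ`, with no flux through the boundary, tested against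
plateau functions. -/
def PlateauContinuityEq (T a b : ℝ) (σ J : ℝ → ℝ → ℝ) : Prop :=
  ∀ (k : ContDiffBump (0 : ℝ)) (α β s t : ℝ), 0 ≤ s → s < t → t ≤ T →
    (∫ x in Ioo a b, σ s x * plateau k α β x) - ∫ x in Ioo a b, σ t x * plateau k α β x =
      ∫ r in s..t, ∫ x in Ioo a b, J r x * deriv (plateau k α β) x

/-- A plateau does not depend on time, so the term with `∂ₜφ` drops out. Test functions need not
vanish at `a` and `b`, hence `α` and `β` are arbitrary. -/
theorem SatisfiesWeakEquation.plateauContinuityEq {T a b : ℝ} {Φ : ℝ → ℝ} {ρ q : ℝ → ℝ → ℝ}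
    (h : SatisfiesWeakEquation T a b Φ ρ q) :
    PlateauContinuityEq T a b ρ fun t x => (q t x + deriv Φ x) * ρ t x := by
  intro k α β s t hs hst ht
  have hc : ContDiff ℝ 1 fun z : ℝ × ℝ => plateau k α β z.2 :=
    ((plateau.contDiff k α β).of_le (by norm_cast)).comp contDiff_snd
  have := h _ hc s t hs hst ht
  simp only [deriv_const, mul_zero, integral_zero, intervalIntegral.integral_zero, neg_zero,
    zero_add] at this
  rw [← this]
  simp only [mul_right_comm]

theorem PlateauContinuityEq.add {T a b : ℝ} {σ₁ σ₂ J₁ J₂ : ℝ → ℝ → ℝ}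
    (h₁ : PlateauContinuityEq T a b σ₁ J₁) (h₂ : PlateauContinuityEq T a b σ₂ J₂)
    (hJ₁ : Integrable (fun z : ℝ × ℝ => J₁ z.1 z.2) (cylinderMeasure T a b))
    (hJ₂ : Integrable (fun z : ℝ × ℝ => J₂ z.1 z.2) (cylinderMeasure T a b))
    (hσ₁ : ∀ t ∈ Icc 0 T, IntegrableOn (σ₁ t) (Ioo a b))
    (hσ₂ : ∀ t ∈ Icc 0 T, IntegrableOn (σ₂ t) (Ioo a b)) :
    PlateauContinuityEq T a b (fun t x => σ₁ t x + σ₂ t x) (fun t x => J₁ t x + J₂ t x) := by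
  intro k α β s t hs hst ht
  have hb : ∀ f : ℝ → ℝ, IntegrableOn f (Ioo a b) →
      IntegrableOn (fun x => f x * plateau k α β x) (Ioo a b) := fun f hf => by
    -- Without `α ≤ β` the plateau may be negative; the triangle inequality gives the bound 2.
    refine Integrable.mul_bdd (c := 1 + 1) hf
      (plateau.contDiff k α β).continuous.aestronglyMeasurable
      (Filter.Eventually.of_forall fun x => ?_)
    refine (norm_sub_le _ _).trans (add_le_add ?_ ?_) <;>
    · rw [Real.norm_eq_abs, abs_of_nonneg (bumpStep.nonneg _ _)]
      exact bumpStep.le_one _ _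
  have hsI : s ∈ Icc 0 T := ⟨hs, hst.le.trans ht⟩
  have htI : t ∈ Icc 0 T := ⟨hs.trans hst.le, ht⟩
  have hii : ∀ J : ℝ → ℝ → ℝ, Integrable (fun z : ℝ × ℝ => J z.1 z.2) (cylinderMeasure T a b) →
      IntervalIntegrable (fun r => ∫ x in Ioo a b, J r x * deriv (plateau k α β) x) volume s t := by
    intro J hJ
    rw [intervalIntegrable_iff_integrableOn_Icc_of_le hst.le]
    exact (integrableOn_integral_slice (integrable_mul_deriv_plateau hJ k α β)).mono_set
      (Icc_subset_Icc hs ht)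
  have hsplit : ∫ r in s..t, ∫ x in Ioo a b, (J₁ r x + J₂ r x) * deriv (plateau k α β) x =
      ∫ r in s..t, ((∫ x in Ioo a b, J₁ r x * deriv (plateau k α β) x) +
        ∫ x in Ioo a b, J₂ r x * deriv (plateau k α β) x) := by
    apply intervalIntegral.integral_congr_ae
    have h1 := ae_integrableOn_slice (integrable_mul_deriv_plateau hJ₁ k α β)
    have h2 := ae_integrableOn_slice (integrable_mul_deriv_plateau hJ₂ k α β)
    rw [ae_restrict_iff' measurableSet_Icc] at h1 h2
    filter_upwards [h1, h2] with r hr1 hr2 hr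
    rw [uIoc_of_le hst.le] at hr
    have hrI : r ∈ Icc 0 T := ⟨hs.trans hr.1.le, hr.2.trans ht⟩
    simp only [add_mul]
    exact integral_add (hr1 hrI) (hr2 hrI)
  rw [hsplit, intervalIntegral.integral_add (hii J₁ hJ₁) (hii J₂ hJ₂), ← h₁ k α β s t hs hst ht,
    ← h₂ k α β s t hs hst ht]
  simp only [add_mul]
  rw [integral_add (hb _ (hσ₁ s hsI)) (hb _ (hσ₂ s hsI)),
    integral_add (hb _ (hσ₁ t htI)) (hb _ (hσ₂ t htI))]
  ring

/-- If the density `σ ≤ 1` solves the continuity equation with flux `J`, then at almost every time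
`J` is constant on the intervals on which `σ = 1`, and zero if the interval reaches beyond
`(a, b)`. -/
theorem PlateauContinuityEq.ae_const {T a b : ℝ} {σ J : ℝ → ℝ → ℝ}
    (h : PlateauContinuityEq T a b σ J)
    (hJ : Integrable (fun z : ℝ × ℝ => J z.1 z.2) (cylinderMeasure T a b))
    (hσ : ∀ t ∈ Icc 0 T, IntegrableOn (σ t) (Ioo a b))
    (hσ1 : ∀ᵐ t ∂volume.restrict (Icc 0 T), ∀ᵐ x, x ∈ Ioo a b → σ t x ≤ 1) :
    ∀ᵐ t ∂volume.restrict (Icc 0 T), ∀ l r, l < r →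
      (∀ᵐ x, x ∈ Ioo l r → x ∈ Ioo a b → σ t x = 1) →
      ∃ c, ∀ᵐ x, x ∈ Ioo l r → (Ioo a b).indicator (J t) x = c := by
  -- The exceptional null set of times depends on the test function; a countable family gives a
  -- common one.
  have hfam : ∀ᵐ t ∂volume.restrict (Icc 0 T), ∀ (n : ℕ) (α β : ℚ), α < β →
      ∫ x in Ioo a b, σ t x * plateau (shrinkingBump n) α β x =
        ∫ x in Ioo a b, plateau (shrinkingBump n) α β x →
      ∫ x in Ioo a b, J t x * deriv (plateau (shrinkingBump n) α β) x = 0 := by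
    simp only [ae_all_iff]
    intro n α β hαβ
    have hαβ' : (α : ℝ) ≤ β := by exact_mod_cast hαβ.le
    refine ae_eq_zero_of_primitive_eq_max
      (integrableOn_integral_slice (integrable_mul_deriv_plateau hJ (shrinkingBump n) α β))
      (h (shrinkingBump n) α β) ?_
    have hpi : IntegrableOn (plateau (shrinkingBump n) α β) (Ioo a b) :=
      ((plateau.contDiff _ α β).continuous.integrableOn_Icc).mono_set Ioo_subset_Icc_self
    filter_upwards [hσ1, ae_restrict_mem measurableSet_Icc] with t ht htI
    refine integral_mono_ae ((hσ t htI).mul_bdd (c := 1)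
      (plateau.contDiff _ α β).continuous.aestronglyMeasurable
      (Filter.Eventually.of_forall fun x => ?_)) hpi ?_
    · rw [Real.norm_eq_abs, abs_of_nonneg (plateau.nonneg _ hαβ' x)]
      exact plateau.le_one _ _ _ _
    · rw [Filter.EventuallyLE, ae_restrict_iff' measurableSet_Ioo]
      filter_upwards [ht] with x hx hxI
      exact mul_le_of_le_one_left (plateau.nonneg _ hαβ' x) (hx hxI)
  filter_upwards [hfam, ae_integrableOn_slice hJ] with t ht hJt l r hlr hs
  exact ae_const_of_saturated hJt ht hlr hs

theorem integrable_flux {T a b L : ℝ} {Φ : ℝ → ℝ} {ρ q : ℝ → ℝ → ℝ}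
    (hq : Integrable (fun z : ℝ × ℝ => q z.1 z.2) (cylinderMeasure T a b))
    (hρ : MemLp (fun z : ℝ × ℝ => ρ z.1 z.2) ⊤ (cylinderMeasure T a b))
    (hΦ : ∀ x ∈ Ioo a b, |deriv Φ x| ≤ L) :
    Integrable (fun z : ℝ × ℝ => (q z.1 z.2 + deriv Φ z.2) * ρ z.1 z.2)
      (cylinderMeasure T a b) := by
  have hd : Integrable (fun z : ℝ × ℝ => deriv Φ z.2) (cylinderMeasure T a b) := by
    refine Integrable.of_bound ((measurable_deriv Φ).comp measurable_snd).aestronglyMeasurable L ?_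
    rw [cylinderMeasure, ae_restrict_iff' (measurableSet_Icc.prod measurableSet_Ioo)]
    exact Filter.Eventually.of_forall fun z hz => hΦ z.2 hz.2
  exact (hq.add hd).mul_of_top_left hρ

/-! ### The main theorem -/

theorem proposition4p8 (L : ℝ≥0) :
    ∃ C : ℝ≥0, ∀ (T a b M₁ M₂ : ℝ) (Φ₁ Φ₂ ρ₁₀ ρ₂₀ : ℝ → ℝ) (ρ₁ ρ₂ p : ℝ → ℝ → ℝ),
      0 < T → a < b → 0 < M₁ → 0 < M₂ →
      OrderedSetting1D a b Φ₁ Φ₂ ρ₁₀ ρ₂₀ →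
      (∀ x ∈ Set.Ioo a b, |deriv Φ₁ x| ≤ L) →
      (∀ x ∈ Set.Ioo a b, |deriv Φ₂ x| ≤ L) →
      IsWeakSolutionPMEInfty T a b M₁ M₂ Φ₁ Φ₂ ρ₁₀ ρ₂₀ ρ₁ ρ₂ p →
      ∀ᵐ t ∂MeasureTheory.volume.restrict (Set.Icc 0 T),
        ∃ u : ℝ → ℝ,
          (∀ᵐ x ∂MeasureTheory.volume.restrict (Set.Ioo a b), p t x = u x) ∧
          LipschitzOnWith C u (Set.Ioo a b) ∧
          IsAsSmoothAsOn (interiorEqOne a b (ρ₁ t)) u Φ₁ ∧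
          IsAsSmoothAsOn (interiorEqOne a b (ρ₂ t)) u Φ₂ ∧
          NegSecondDerivEqOn (interiorEqOne a b (ρ₁ t)) u Φ₁ ∧
          NegSecondDerivEqOn (interiorEqOne a b (ρ₂ t)) u Φ₂ := by
  -- One `L` bounds the constant flux, the other the averaged drift.
  refine ⟨2 * L, ?_⟩
  intro T a b M₁ M₂ Φ₁ Φ₂ ρ₁₀ ρ₂₀ ρ₁ ρ₂ p _ hab _ _ hset hΦ₁ hΦ₂ hsol
  obtain ⟨hρ₁, hρ₂, hsum, hp0, hcompl, -, -, q, hpL, hqL, hweak, heq₁, heq₂⟩ := hsol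
  have hq : Integrable (fun z : ℝ × ℝ => q z.1 z.2) (cylinderMeasure T a b) :=
    hqL.integrable one_le_two
  have hJ₁ := integrable_flux hq hρ₁.memLp_top hΦ₁
  have hJ₂ := integrable_flux hq hρ₂.memLp_top hΦ₂
  have hle : ∀ᵐ t ∂volume.restrict (Icc 0 T), ∀ᵐ x, x ∈ Ioo a b → ρ₁ t x + ρ₂ t x ≤ 1 := by
    apply ae_slice_of_ae_cylinder (P := fun z => ρ₁ z.1 z.2 + ρ₂ z.1 z.2 ≤ 1)
    rw [eLpNorm_exponent_top] at hsum
    filter_upwards [ae_le_eLpNormEssSup (f := fun z : ℝ × ℝ => ρ₁ z.1 z.2 + ρ₂ z.1 z.2)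
      (μ := cylinderMeasure T a b)] with z hz
    have h1 := hz.trans hsum
    rw [← ofReal_norm, ENNReal.ofReal_le_one] at h1
    exact (le_abs_self _).trans h1
  have hnn : ∀ᵐ t ∂volume.restrict (Icc 0 T), ∀ᵐ x, x ∈ Ioo a b → 0 ≤ ρ₁ t x ∧ 0 ≤ ρ₂ t x := by
    filter_upwards [ae_restrict_mem measurableSet_Icc] with t ht
    have h1 := hρ₁.nonneg t ht
    have h2 := hρ₂.nonneg t ht
    rw [ae_restrict_iff' measurableSet_Ioo] at h1 h2
    filter_upwards [h1, h2] with x hx1 hx2 hx using ⟨hx1 hx, hx2 hx⟩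
  have hc₁ := heq₁.plateauContinuityEq.ae_const hJ₁ hρ₁.integrable (by
    filter_upwards [hle, hnn] with t h1 h2
    filter_upwards [h1, h2] with x hx1 hx2 hx
    linarith [hx1 hx, (hx2 hx).2])
  have hc₂ := heq₂.plateauContinuityEq.ae_const hJ₂ hρ₂.integrable (by
    filter_upwards [hle, hnn] with t h1 h2
    filter_upwards [h1, h2] with x hx1 hx2 hx
    linarith [hx1 hx, (hx2 hx).1])
  -- The sum of the two species serves the Lipschitz bound; the single species above serve the
  -- regularity.
  have hc := (heq₁.plateauContinuityEq.add heq₂.plateauContinuityEq hJ₁ hJ₂ hρ₁.integrable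
    hρ₂.integrable).ae_const (hJ₁.add hJ₂)
    (fun t ht => (hρ₁.integrable t ht).add (hρ₂.integrable t ht)) hle
  filter_upwards [hle, hnn, hc₁, hc₂, hc, hweak, ae_integrableOn_slice (hpL.integrable one_le_two),
    ae_integrableOn_slice hq, ae_slice_of_ae_cylinder hp0, ae_slice_of_ae_cylinder hcompl]
    with t hle hnn hc₁ hc₂ hc hweak hpt hqt hp0 hcompl
  obtain ⟨c₀, hc₀⟩ := hweak.exists_primitive hab hpt hqt
  set u : ℝ → ℝ := fun x => c₀ + ∫ s in a..x, (Ioo a b).indicator (q t) s with hu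
  have hqi : Integrable ((Ioo a b).indicator (q t)) := hqt.integrable_indicator measurableSet_Ioo
  have hcont : Continuous u := continuous_const.add
    (intervalIntegral.continuous_primitive (fun _ _ => hqi.intervalIntegrable) a)
  have hunn : ∀ x ∈ Ioo a b, 0 ≤ u x := by
    have ho : IsOpen (Ioo a b ∩ {x | u x < 0}) := isOpen_Ioo.inter (isOpen_lt hcont continuous_const)
    have h0 : volume (Ioo a b ∩ {x | u x < 0}) = 0 := by
      refine measure_mono_null ?_ (hc₀.and hp0)
      rintro x ⟨hx, hlt⟩ ⟨h1, h2⟩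
      have h3 := h2 hx
      rw [h1 hx] at h3
      exact absurd hlt (not_lt.2 h3)
    have he := ho.eq_empty_of_measure_zero h0
    intro x hx
    by_contra! hlt
    exact (he ▸ (⟨hx, hlt⟩ : x ∈ Ioo a b ∩ {x | u x < 0}) : x ∈ (∅ : Set ℝ))
  have hsat : ∀ᵐ x, x ∈ Ioo a b → 0 < u x → ρ₁ t x + ρ₂ t x = 1 := by
    filter_upwards [hc₀, hcompl] with x h1 h2 hx hpos
    have h3 := h2 hx
    rw [h1 hx] at h3
    rcases mul_eq_zero.1 h3 with h | h
    · exact absurd h hpos.ne'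
    · linarith
  have hbound : ∀ᵐ x, |(Ioo a b).indicator (q t) x| ≤ 2 * L := by
    refine ae_abs_le_of_flux_const (L := (L : ℝ)) (u := u)
      -- Where `u > 0` the weights `ρ₁, ρ₂ ≥ 0` add up to 1, which yields both `|g| ≤ L` and `J = q
      -- + g`.
      (g := fun x => deriv Φ₁ x * ρ₁ t x + deriv Φ₂ x * ρ₂ t x)
      (J := fun x => (q t x + deriv Φ₁ x) * ρ₁ t x + (q t x + deriv Φ₂ x) * ρ₂ t x)
      L.coe_nonneg hqt (fun x => rfl) hunn ?_ ?_ ?_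
    · filter_upwards [hsat, hnn] with x h1 h2 hx hpos
      obtain ⟨h3, h4⟩ := h2 hx
      have h5 := abs_le.1 (hΦ₁ x hx)
      have h6 := abs_le.1 (hΦ₂ x hx)
      have h7 := h1 hx hpos
      have h8 : (L : ℝ) = L * ρ₁ t x + L * ρ₂ t x := by rw [← mul_add, h7, mul_one]
      rw [abs_le]
      constructor
      · have e1 := mul_le_mul_of_nonneg_right h5.1 h3
        have e2 := mul_le_mul_of_nonneg_right h6.1 h4
        linarith
      · have e1 := mul_le_mul_of_nonneg_right h5.2 h3
        have e2 := mul_le_mul_of_nonneg_right h6.2 h4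
        linarith
    · filter_upwards [hsat] with x h1 hx hpos
      linear_combination (q t x) * h1 hx hpos
    · intro l r hlr hpos
      refine hc l r hlr ?_
      filter_upwards [hsat] with x h1 hx hxab using h1 hxab (hpos x hx hxab)
  have haff : ∀ (Φ ρ : ℝ → ℝ), ContDiffOn ℝ 1 Φ (Ioo a b) →
      (∀ l r, l < r → (∀ᵐ x, x ∈ Ioo l r → x ∈ Ioo a b → ρ x = 1) →
        ∃ c, ∀ᵐ x, x ∈ Ioo l r → (Ioo a b).indicator (fun x => (q t x + deriv Φ x) * ρ x) x = c) →
      AffineSumOn (interiorEqOne a b ρ) u Φ := by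
    intro Φ ρ hΦ hconst
    refine affineSumOn_interiorEqOne hqt (fun x => rfl) hΦ fun l r hlr hsub hρ => ?_
    obtain ⟨c, hc⟩ := hconst l r hlr (hρ.mono fun x hx hxI _ => hx hxI)
    refine ⟨c, ?_⟩
    filter_upwards [hc, hρ] with x h1 h2 hx
    rw [← h1 hx, indicator_of_mem (hsub hx), h2 hx, mul_one]
  have ha₁ := haff Φ₁ (ρ₁ t) hset.contDiff₁ hc₁
  have ha₂ := haff Φ₂ (ρ₂ t) hset.contDiff₂ hc₂
  have hopen : ∀ ρ, IsOpen (interiorEqOne a b ρ) := fun ρ => isOpen_sUnion fun V hV => hV.1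
  have hsub : ∀ ρ, interiorEqOne a b ρ ⊆ Ioo a b := fun ρ => sUnion_subset fun V hV => hV.2.1
  refine ⟨u, (ae_restrict_iff' measurableSet_Ioo).2 hc₀,
    lipschitzOnWith_of_ae_abs_le hqi (fun x => rfl) (by simpa using hbound) _,
    ha₁.isAsSmoothAsOn, ha₂.isAsSmoothAsOn,
    ha₁.negSecondDerivEqOn hcont.continuousOn (hset.contDiff₁.continuousOn.mono (hsub _)) (hopen _),
    ha₂.negSecondDerivEqOn hcont.continuousOn (hset.contDiff₂.continuousOn.mono (hsub _)) (hopen _)⟩
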